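/- **Setting.** Fix positive integers $L,H,d_a,V,N$ and put $d_x=Hd_a$. A depth-$L$, $H$-headed, width-$d_x$ self-attention network has learned parameters $\theta=(\mathcal W,M^{\mathrm V})$: matrices $W^{\mathrm K,l,h},W^{\mathrm Q,l,h},W^{\mathrm V,l,h}\in\mathbb R^{d_a\times d_x}$ and $W^{\mathrm O,l,h}\in\mathbb R^{d_x\times d_a}$ for each layer $l$ and head $h$, and a vocabulary matrix $M^{\mathrm V}\in\mathbb R^{d_x\times V}$, whose $w$-th column $E_{M^{\mathrm V}}(w)$ is the embedding of the word $w\in[V]$. On input vectors $\mathbf x^1,\dots,\mathbf x^N\in\mathbb R^{d_x}$ it computes $\mathbf g^{i,0}=\mathbf x^i$ and $$\mathbf g^{i,l+1}=\sum_{h=1}^H W^{\mathrm O,l,h}\sum_{j=1}^N\langle W^{\mathrm Q,l,h}\mathbf g^{i,l},W^{\mathrm K,l,h}\mathbf g^{j,l}\rangle\, W^{\mathrm V,l,h}\mathbf g^{j,l}.$$ Its output $\mathbf y_\theta^{i}(w^1,\dots,w^N)$ is $\mathbf g^{i,L}$ for $\mathbf x^j=E_{M^{\mathrm V}}(w^j)$.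 Let $S_1=(w_1^1,\dots,w_1^N)$, with following word $w_1^{N+1}$, and $S_2=(w_2^1,\dots,w_2^N)$ be sentences, and $$\mathcal L(S_1)=-\sum_{j=1}^N\log\Big[\mathrm{softmax}\big\{(M^{\mathrm V})^\top\mathbf y_\theta^{j}(S_1)\big\}_{w_1^{j+1}}\Big].$$ The sequential representation with learning rate $\eta$ is $\mathbf y^{i}_{\theta'}(S_2)$, where $\theta'=\theta-\eta\,\partial\mathcal L(S_1)/\partial\theta$; its $p$-th entry is denoted $y=y^{(p,i),L,d_x,\eta}_{\mathrm{sequential}}$. For $\mathbf a,\mathbf b\in\mathbb R^{d_x}$ let $\mathcal L(S_1;\mathbf a)$ be the loss computed with each input embedding $E_{M^{\mathrm V}}(w_1^j)$ replaced by its entrywise product with $\mathbf a$, and let $\mathcal Z_y(\mathbf a,\mathbf b)$ be the $p$-th entry at location $i$ of the network with parameters $\theta-\eta\,\partial\mathcal L(S_1;\mathbf a)/\partial\theta$, evaluated on $S_2$ with each (updated) input embedding multiplied entrywise by $\mathbf b$. The separation rank $\mathrm{sep}(f)$ of $f:A\times B\to\mathbb R$ is the least $R\in\mathbb N$ such that $f(\mathbf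 a,\mathbf b)=\sum_{r=1}^R g_r(\mathbf a)g'_r(\mathbf b)$ for some functions $g_r:A\to\mathbb R$, $g_r':B\to\mathbb R$; $\varepsilon\text{-}\mathrm{sep}(f)$ is the least $R'\le\mathrm{sep}(f)$ in $\mathbb N$ that is the separation rank of some $\tilde f$ with $|\tilde f-f|\le\varepsilon$ on $A\times B$. Let $A,B\subseteq\mathbb R^{d_x}$ be the domains of $\mathbf a$ and $\mathbf b$; $\varepsilon\text{-seq-sep}(y)$ is $\varepsilon\text{-}\mathrm{sep}$ of $\mathcal Z_y$ on $A\times B$. **Theorem.** Assume that for some $0<\Lambda_{\min}\le\Lambda_{\max}$ every scalar parameter satisfies $\Lambda_{\min}\le|\theta|\le\Lambda_{\max}$, and $\Lambda_{\min}\le|\partial\mathcal L(S_1;\mathbf a)/\partial\theta|\le\Lambda_{\max}$ for all $\mathbf a\in A$; that $N<d_x$, $\eta\in(0,1]$, $\frac{2(1+\eta)d_x}{\eta}<3^L$ and $2(1+\eta)d_x^2<3^L$; and that $\mathcal Z_y$ can be written on $A\times B$ as a finite sum of terms, the absolute values of which add up to less than some $M\ge0$ at every point of $A\times B$. Then, for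 every $\varepsilon>0$, $\varepsilon\text{-seq-sep}(y)$ is finite and $$\log\big[\varepsilon\text{-seq-sep}(y)\big]=\tilde O\big([L+0.5\log_3\eta]\cdot d_x\big),$$ that is, the left side is at most $C\,(1+\log d_x+\log L+\log H)^{\kappa}\,[L+0.5\log_3\eta]\,d_x$ with universal constants $C>0$ and $\kappa\in\mathbb N$, independent of $L,H,d_x,N,V,\eta,\varepsilon,\Lambda_{\min},\Lambda_{\max},M,\theta,S_1,S_2,A,B,p,i$. (If the rank is $0$, the left side is read as $0$, and the right side is nonnegative.) -/

import Mathlib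

noncomputable section

namespace SeqNLM

open scoped Matrix

/-! ### Separation rank -/

/-- The separation rank of `y : α → β → ℝ` with respect to its two groups of variables: the least
number of multiplicatively separable summands adding up to `y` (and `⊤` if there is no finite such
number). -/
def sepRank {α β : Type*} (y : α → β → ℝ) : ℕ∞ :=
  sInf {R : ℕ∞ | ∃ n : ℕ, R = (n : ℕ∞) ∧
    ∃ (g : Fin n → α → ℝ) (g' : Fin n → β → ℝ), ∀ a b, y a b = ∑ r, g r a * g' r b}

/-- The effective (`ε`-) separation rank: the least finite separation rank, not exceeding the one
of `y`, of a function that is uniformly within `ε` of `y`. -/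
def epsSepRank {α β : Type*} (ε : ℝ) (y : α → β → ℝ) : ℕ∞ :=
  sInf {R : ℕ∞ | ∃ n : ℕ, R = (n : ℕ∞) ∧ R ≤ sepRank y ∧
    ∃ y' : α → β → ℝ, sepRank y' = R ∧ ∀ a b, |y' a b - y a b| ≤ ε}

/-! ### The network -/

/-- Indices of the scalar learned parameters of a depth `L` network with `H` heads, head dimension
`da`, width `dx` and vocabulary size `V`: the entries of the key, query, value and output matrices
of every layer and head, and those of the `dx × V` vocabulary embedding matrix. -/
inductive ParamIdx (L H da dx V : ℕ) : Type
  | key (l : Fin L) (h : Fin H) (r : Fin da) (α : Fin dx)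
  | query (l : Fin L) (h : Fin H) (r : Fin da) (α : Fin dx)
  | value (l : Fin L) (h : Fin H) (r : Fin da) (α : Fin dx)
  | output (l : Fin L) (h : Fin H) (α : Fin dx) (r : Fin da)
  | vocab (α : Fin dx) (w : Fin V)
  deriving DecidableEq

/-- An assignment of all learned parameters. -/
abbrev Params (L H da dx V : ℕ) : Type := ParamIdx L H da dx V → ℝ

variable {L H da dx V N : ℕ}

def Params.WK (θ : Params L H da dx V) (l : Fin L) (h : Fin H) : Matrix (Fin da) (Fin dx) ℝ :=
  Matrix.of fun r α => θ (.key l h r α)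

def Params.WQ (θ : Params L H da dx V) (l : Fin L) (h : Fin H) : Matrix (Fin da) (Fin dx) ℝ :=
  Matrix.of fun r α => θ (.query l h r α)

def Params.WV (θ : Params L H da dx V) (l : Fin L) (h : Fin H) : Matrix (Fin da) (Fin dx) ℝ :=
  Matrix.of fun r α => θ (.value l h r α)

def Params.WO (θ : Params L H da dx V) (l : Fin L) (h : Fin H) : Matrix (Fin dx) (Fin da) ℝ :=
  Matrix.of fun α r => θ (.output l h α r)

/-- The word embedding of `w`: the `w`-th column of the vocabulary embedding matrix. -/
def embed (θ : Params L H da dx V) (w : Fin V) : Fin dx → ℝ := fun α => θ (.vocab α w)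

/-- One self-attention layer, without softmax and ReLU, with the weights of layer `l`. -/
def attnLayer (θ : Params L H da dx V) (l : Fin L) (x : Fin N → Fin dx → ℝ) (i : Fin N) :
    Fin dx → ℝ :=
  ∑ h : Fin H, θ.WO l h *ᵥ ∑ j : Fin N,
    ((θ.WQ l h *ᵥ x i) ⬝ᵥ (θ.WK l h *ᵥ x j)) • (θ.WV l h *ᵥ x j)

/-- The activations after the first `l` layers on the input vectors `x`. -/
def hidden (θ : Params L H da dx V) (x : Fin N → Fin dx → ℝ) :
    (l : ℕ) → l ≤ L → Fin N → Fin dx → ℝ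
  | 0, _ => x
  | l + 1, h => attnLayer θ ⟨l, h⟩ (hidden θ x l (Nat.le_of_succ_le h))

/-- The self-attention stack: all `L` layers. -/
def stack (θ : Params L H da dx V) (x : Fin N → Fin dx → ℝ) : Fin N → Fin dx → ℝ :=
  hidden θ x L le_rfl

/-- The network output on a sequence of words. -/
def transformer (θ : Params L H da dx V) (w : Fin N → Fin V) : Fin N → Fin dx → ℝ :=
  stack θ fun j => embed θ (w j)

/-- The network output when the sentence association layer with variable `s` is applied to the
input embeddings: each embedding is multiplied entrywise by `s`. -/
def transformerAssoc (θ : Params L H da dx V) (s : Fin dx → ℝ) (w : Fin N → Fin V) :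
    Fin N → Fin dx → ℝ :=
  stack θ fun j => embed θ (w j) * s

/-! ### The loss, the gradient step and the sequential representation -/

/-- The `w`-th entry of the softmax of a vector of logits. -/
def softmax (z : Fin V → ℝ) (w : Fin V) : ℝ := Real.exp (z w) / ∑ v, Real.exp (z v)

/-- The logits of an output vector `y`: the transposed vocabulary matrix applied to `y`. -/
def logits (θ : Params L H da dx V) (y : Fin dx → ℝ) : Fin V → ℝ := fun v => embed θ v ⬝ᵥ y

/-- The autoregressive negative log-likelihood of a sentence. The words `S 0, …, S (N-1)` are
the input, and the target at position `j` is the next word `S (j+1)`; so `S N` is the word that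
follows the sentence. -/
def loss (S : Fin (N + 1) → Fin V) (θ : Params L H da dx V) : ℝ :=
  -∑ j : Fin N, Real.log
    (softmax (logits θ (transformer θ (fun k : Fin N => S k.castSucc) j)) (S j.succ))

/-- The same loss, with the sentence association layer with variable `a` applied to all uses of
the input embedding layer. -/
def lossAssoc (S : Fin (N + 1) → Fin V) (a : Fin dx → ℝ) (θ : Params L H da dx V) : ℝ :=
  -∑ j : Fin N, Real.log
    (softmax (logits θ (transformerAssoc θ a (fun k : Fin N => S k.castSucc) j)) (S j.succ))

/-- The partial derivative of `f` with respect to the scalar parameter `k`, at `θ`. -/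
def partialDeriv (f : Params L H da dx V → ℝ) (θ : Params L H da dx V)
    (k : ParamIdx L H da dx V) : ℝ :=
  deriv (fun t : ℝ => f (Function.update θ k t)) (θ k)

/-- One gradient step of learning rate `η` on the loss `f`, for all learned parameters. -/
def gradStep (η : ℝ) (f : Params L H da dx V → ℝ) (θ : Params L H da dx V) :
    Params L H da dx V :=
  fun k => θ k - η * partialDeriv f θ k

/-- The sequential representation: one gradient step on `S₁`, then evaluation on `S₂`. -/
def seqRep (θ : Params L H da dx V) (η : ℝ) (S₁ : Fin (N + 1) → Fin V) (S₂ : Fin N → Fin V) :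
    Fin N → Fin dx → ℝ :=
  transformer (gradStep η (loss S₁) θ) S₂

/-- The sentence association operation on the sequential representation: every embedding used as
input because of `S₁` is multiplied entrywise by `a`, and every one used because of `S₂` by `b`.
-/
def seqRepAssoc (θ : Params L H da dx V) (η : ℝ) (S₁ : Fin (N + 1) → Fin V) (S₂ : Fin N → Fin V)
    (a b : Fin dx → ℝ) : Fin N → Fin dx → ℝ :=
  transformerAssoc (gradStep η (lossAssoc S₁ a) θ) b S₂

/-- With both association variables equal to the all-ones vector, nothing changes. -/
theorem seqRepAssoc_one (θ : Params L H da dx V) (η : ℝ) (S₁ : Fin (N + 1) → Fin V)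
    (S₂ : Fin N → Fin V) : seqRepAssoc θ η S₁ S₂ 1 1 = seqRep θ η S₁ S₂ := by
  have h : lossAssoc (L := L) (H := H) (da := da) (dx := dx) S₁ 1 = loss S₁ := by
    funext θ'
    simp [lossAssoc, loss, transformerAssoc, transformer]
  simp [seqRepAssoc, seqRep, transformerAssoc, transformer, h]

/-- The `ε`-sequential-separation rank of entry `p` at location `i` of the sequential
representation, where the association variables `a` and `b` range over `A` and `B`. -/
def epsSeqSep (ε : ℝ) (θ : Params L H da dx V) (η : ℝ) (S₁ : Fin (N + 1) → Fin V)
    (S₂ : Fin N → Fin V) (A B : Set (Fin dx → ℝ)) (p : Fin dx) (i : Fin N) : ℕ∞ :=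
  epsSepRank ε fun (a : A) (b : B) => seqRepAssoc θ η S₁ S₂ a b i p

end SeqNLM

end

open SeqNLM

/-!
The gradient step is taken before `b` enters, so for fixed `a` the sequential representation on
`S₂` is the network with some fixed parameters applied to inputs that are linear in `b`. Every
layer is cubic in its input, so the result is a polynomial in `b` of degree at most `3 ^ L`.
Expanding it in monomials separates `a`, which enters only through the coefficients, from `b`, and
there are at most `(3 ^ L + 1) ^ dx` monomials. The assumption on the depth forces
`-L ≤ logb 3 η`, so the exponent `L` is at most twice `L + 0.5 * logb 3 η`, and no logarithmic
factor is lost.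
-/

namespace SeqNLM

open Finset
open scoped Matrix

section PolynomialFunctions

variable {R σ : Type*} [CommSemiring R] {D E : ℕ}

/-- `f` is a polynomial function of total degree at most `D`. A predicate on functions, so that it
applies directly to the activations of the network. -/
def IsPolynomialOfDegreeLE (D : ℕ) (f : (σ → R) → R) : Prop :=
  ∃ P : MvPolynomial σ R, P.totalDegree ≤ D ∧ ∀ x, f x = MvPolynomial.eval x P

namespace IsPolynomialOfDegreeLE

theorem const (c : R) : IsPolynomialOfDegreeLE 0 fun _ : σ → R => c :=
  ⟨.C c, by simp, fun x => by simp⟩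

theorem coord (s : σ) : IsPolynomialOfDegreeLE 1 fun x : σ → R => x s :=
  ⟨.X s, (MvPolynomial.totalDegree_monomial_le _ _).trans (by simp), fun x => by simp⟩

theorem mul {f g : (σ → R) → R} (hf : IsPolynomialOfDegreeLE D f)
    (hg : IsPolynomialOfDegreeLE E g) : IsPolynomialOfDegreeLE (D + E) fun x => f x * g x := by
  obtain ⟨P, hP, hfP⟩ := hf
  obtain ⟨Q, hQ, hgQ⟩ := hg
  exact ⟨P * Q, (MvPolynomial.totalDegree_mul P Q).trans (add_le_add hP hQ),
    fun x => by simp [hfP, hgQ]⟩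

theorem const_mul (c : R) {f : (σ → R) → R} (hf : IsPolynomialOfDegreeLE D f) :
    IsPolynomialOfDegreeLE D fun x => c * f x := by
  simpa only [zero_add] using (const c).mul hf

theorem sum {ι : Type*} (s : Finset ι) {f : ι → (σ → R) → R}
    (hf : ∀ i ∈ s, IsPolynomialOfDegreeLE D (f i)) :
    IsPolynomialOfDegreeLE D fun x => ∑ i ∈ s, f i x := by
  choose! P hP hfP using hf
  refine ⟨∑ i ∈ s, P i, MvPolynomial.totalDegree_finsetSum_le hP, fun x => ?_⟩
  rw [map_sum]
  exact sum_congr rfl fun i hi => hfP i hi x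

theorem mulVec {m n : Type*} [Fintype n] (W : Matrix m n R) {v : (σ → R) → n → R}
    (hv : ∀ k, IsPolynomialOfDegreeLE D fun x => v x k) (r : m) :
    IsPolynomialOfDegreeLE D fun x => (W *ᵥ v x) r :=
  sum univ fun k _ => (hv k).const_mul (W r k)

theorem dotProduct {n : Type*} [Fintype n] {v w : (σ → R) → n → R}
    (hv : ∀ k, IsPolynomialOfDegreeLE D fun x => v x k)
    (hw : ∀ k, IsPolynomialOfDegreeLE E fun x => w x k) :
    IsPolynomialOfDegreeLE (D + E) fun x => v x ⬝ᵥ w x :=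
  sum univ fun k _ => (hv k).mul (hw k)

end IsPolynomialOfDegreeLE

variable [Fintype σ] [DecidableEq σ]

/-- The exponents of the monomials in the variables `σ` in which every variable has degree at most
`D`. This box contains all exponents of total degree at most `D` and has a simpler cardinality. -/
noncomputable def boxExponents (σ : Type*) [Fintype σ] [DecidableEq σ] (D : ℕ) :
    Finset (σ →₀ ℕ) :=
  Iic (Finsupp.equivFunOnFinite.symm fun _ => D)

theorem mem_boxExponents {e : σ →₀ ℕ} : e ∈ boxExponents σ D ↔ ∀ s, e s ≤ D :=
  mem_Iic

theorem card_boxExponents (σ : Type*) [Fintype σ] [DecidableEq σ] (D : ℕ) :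
    #(boxExponents σ D) = (D + 1) ^ Fintype.card σ := by
  set d : σ →₀ ℕ := Finsupp.equivFunOnFinite.symm fun _ => D with hd
  calc #(Iic d) = ∏ s ∈ d.support, #(Iic (d s)) := Finsupp.card_Iic d
    _ = ∏ s, #(Iic (d s)) := prod_subset (subset_univ _) fun s _ hs => by
        rw [Finsupp.notMem_support_iff.1 hs, Nat.card_Iic, zero_add]
    _ = (D + 1) ^ Fintype.card σ := by simp [hd]

theorem IsPolynomialOfDegreeLE.exists_coeff {f : (σ → R) → R}
    (hf : IsPolynomialOfDegreeLE D f) :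
    ∃ c : (σ →₀ ℕ) → R, ∀ x, f x = ∑ e ∈ boxExponents σ D, c e * ∏ s, x s ^ e s := by
  obtain ⟨P, hP, hfP⟩ := hf
  have support_subset : P.support ⊆ boxExponents σ D := fun e he =>
    mem_boxExponents.2 fun s =>
      (Finsupp.le_degree s e).trans ((MvPolynomial.le_totalDegree he).trans hP)
  refine ⟨P.coeff, fun x => ?_⟩
  rw [hfP, MvPolynomial.eval_eq']
  exact sum_subset support_subset fun e _ he => by
    rw [MvPolynomial.notMem_support_iff.1 he, zero_mul]

end PolynomialFunctions

section SeparationRank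

variable {α β : Type*}

theorem sepRank_le_card {ι : Type*} (s : Finset ι) {y : α → β → ℝ} (g : ι → α → ℝ)
    (g' : ι → β → ℝ) (h : ∀ a b, y a b = ∑ i ∈ s, g i a * g' i b) : sepRank y ≤ #s := by
  refine sInf_le ⟨#s, rfl, fun r => g (s.equivFin.symm r), fun r => g' (s.equivFin.symm r),
    fun a b => ?_⟩
  rw [h, ← sum_coe_sort]
  exact (s.equivFin.symm.sum_comp fun i => g i a * g' i b).symm

theorem epsSepRank_le_sepRank {ε : ℝ} (hε : 0 ≤ ε) (y : α → β → ℝ) :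
    epsSepRank ε y ≤ sepRank y := by
  by_cases htop : sepRank y = ⊤
  · simp only [htop, le_top]
  · obtain ⟨n, hn⟩ := ENat.ne_top_iff_exists.1 htop
    exact sInf_le ⟨n, hn.symm, le_rfl, y, rfl, fun a b => by simpa using hε⟩

theorem sepRank_le_of_isPolynomialOfDegreeLE {σ : Type*} [Fintype σ] {D : ℕ}
    {f : α → (σ → ℝ) → ℝ} (hf : ∀ a, IsPolynomialOfDegreeLE D (f a)) (x : β → σ → ℝ) :
    sepRank (fun a b => f a (x b)) ≤ ((D + 1) ^ Fintype.card σ : ℕ) := by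
  classical
  choose c hc using fun a => (hf a).exists_coeff
  rw [← card_boxExponents]
  exact sepRank_le_card _ (fun e a => c a e) (fun e b => ∏ s, x b s ^ e s) fun a b => hc a (x b)

end SeparationRank

section Network

variable {L H da dx V N : ℕ} {σ : Type*} {D : ℕ}

theorem attnLayer_apply (θ : Params L H da dx V) (l : Fin L) (x : Fin N → Fin dx → ℝ)
    (i : Fin N) (p : Fin dx) :
    attnLayer θ l x i p = ∑ h, (θ.WO l h *ᵥ fun r =>
      ∑ j, (θ.WQ l h *ᵥ x i) ⬝ᵥ (θ.WK l h *ᵥ x j) * (θ.WV l h *ᵥ x j) r) p := by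
  rw [attnLayer, Finset.sum_apply]
  refine sum_congr rfl fun h _ => congrFun (congrArg _ (funext fun r => ?_)) p
  simp only [Finset.sum_apply, Pi.smul_apply, smul_eq_mul]

theorem isPolynomialOfDegreeLE_attnLayer (θ : Params L H da dx V) (l : Fin L)
    {x : (σ → ℝ) → Fin N → Fin dx → ℝ}
    (hx : ∀ j q, IsPolynomialOfDegreeLE D fun b => x b j q) (i : Fin N) (p : Fin dx) :
    IsPolynomialOfDegreeLE (3 * D) fun b => attnLayer θ l (x b) i p := by
  simp only [attnLayer_apply]
  refine .sum _ fun h _ => .mulVec _ (fun r => .sum _ fun j _ => ?_) p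
  have hquery := IsPolynomialOfDegreeLE.mulVec (θ.WQ l h) (hx i)
  have hkey := IsPolynomialOfDegreeLE.mulVec (θ.WK l h) (hx j)
  have hvalue := IsPolynomialOfDegreeLE.mulVec (θ.WV l h) (hx j) r
  rw [show 3 * D = D + D + D by ring]
  exact (IsPolynomialOfDegreeLE.dotProduct hquery hkey).mul hvalue

theorem isPolynomialOfDegreeLE_hidden (θ : Params L H da dx V)
    {x : (σ → ℝ) → Fin N → Fin dx → ℝ}
    (hx : ∀ j q, IsPolynomialOfDegreeLE D fun b => x b j q) (l : ℕ) (hl : l ≤ L) (i : Fin N)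
    (p : Fin dx) : IsPolynomialOfDegreeLE (3 ^ l * D) fun b => hidden θ (x b) l hl i p := by
  induction l generalizing i p with
  | zero => simpa only [hidden, pow_zero, one_mul] using hx i p
  | succ l ih =>
    rw [pow_succ', mul_assoc]
    exact isPolynomialOfDegreeLE_attnLayer θ ⟨l, hl⟩ (ih (Nat.le_of_succ_le hl)) i p

theorem isPolynomialOfDegreeLE_transformerAssoc (θ : Params L H da dx V) (w : Fin N → Fin V)
    (i : Fin N) (p : Fin dx) :
    IsPolynomialOfDegreeLE (3 ^ L) fun b => transformerAssoc θ b w i p := by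
  have hinput (j : Fin N) (q : Fin dx) :
      IsPolynomialOfDegreeLE 1 fun b : Fin dx → ℝ => (embed θ (w j) * b) q :=
    (IsPolynomialOfDegreeLE.coord q).const_mul (embed θ (w j) q)
  simpa only [mul_one, transformerAssoc, stack] using
    isPolynomialOfDegreeLE_hidden θ hinput L le_rfl i p

theorem epsSeqSep_le {ε : ℝ} (hε : 0 ≤ ε) (θ : Params L H da dx V) (η : ℝ)
    (S₁ : Fin (N + 1) → Fin V) (S₂ : Fin N → Fin V) (A B : Set (Fin dx → ℝ)) (p : Fin dx)
    (i : Fin N) : epsSeqSep ε θ η S₁ S₂ A B p i ≤ ((3 ^ L + 1) ^ dx : ℕ) := by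
  have hpoly (a : A) : IsPolynomialOfDegreeLE (3 ^ L) fun b => seqRepAssoc θ η S₁ S₂ a b i p :=
    isPolynomialOfDegreeLE_transformerAssoc _ S₂ i p
  simpa only [Fintype.card_fin, epsSeqSep] using
    (epsSepRank_le_sepRank hε _).trans (sepRank_le_of_isPolynomialOfDegreeLE hpoly fun b : B => b)

end Network

theorem log_le_of_le_three_pow_add_one_pow {R L d : ℕ} (hL : L ≠ 0)
    (hR : R ≤ (3 ^ L + 1) ^ d) : Real.log R ≤ Real.log 4 * (L * d) := by
  rcases R.eq_zero_or_pos with rfl | hR₀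
  · rw [Nat.cast_zero, Real.log_zero]
    positivity
  have hR₄ : R ≤ 4 ^ (L * d) := calc
    R ≤ (3 ^ L + 1) ^ d := hR
    _ ≤ (4 ^ L) ^ d := by
      gcongr
      simpa only [one_pow] using pow_add_pow_le (Nat.zero_le 3) (Nat.zero_le 1) hL
    _ = 4 ^ (L * d) := (pow_mul 4 L d).symm
  calc Real.log R ≤ Real.log (4 ^ (L * d)) :=
        Real.log_le_log (by exact_mod_cast hR₀) (by exact_mod_cast hR₄)
    _ = Real.log 4 * (L * d) := by rw [Real.log_pow, Nat.cast_mul, mul_comm]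

theorem neg_natCast_le_logb_of_inv_le_pow {b x : ℝ} {n : ℕ} (hb : 1 < b) (hx : 0 < x)
    (h : x⁻¹ ≤ b ^ n) : -(n : ℝ) ≤ Real.logb b x := by
  rw [Real.le_logb_iff_rpow_le hb hx, Real.rpow_neg (by positivity), Real.rpow_natCast]
  exact inv_le_of_inv_le₀ hx h

theorem one_add_inv_le_two_mul_div {η d : ℝ} (hη : 0 < η) (hd : 1 ≤ d) :
    1 + η⁻¹ ≤ 2 * (1 + η) * d / η := by
  rw [le_div_iff₀ hη, add_mul, inv_mul_cancel₀ hη.ne', one_mul]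
  nlinarith

end SeqNLM

theorem theorem1_general {L H da dx V N : ℕ} {η ε : ℝ} (hη : 0 < η)
    (hdepth : 1 + η⁻¹ ≤ 3 ^ L) (hε : 0 ≤ ε) (θ : Params L H da dx V)
    (S₁ : Fin (N + 1) → Fin V) (S₂ : Fin N → Fin V) (A B : Set (Fin dx → ℝ)) (p : Fin dx)
    (i : Fin N) :
    ∃ R : ℕ, epsSeqSep ε θ η S₁ S₂ A B p i = (R : ℕ∞) ∧
      Real.log R ≤ 2 * Real.log 4 * ((L + 0.5 * Real.logb 3 η) * dx) := by
  have hrank := epsSeqSep_le hε θ η S₁ S₂ A B p i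
  obtain ⟨R, hR⟩ := ENat.ne_top_iff_exists.1 (ne_top_of_le_ne_top (ENat.natCast_ne_top _) hrank)
  have hRle : R ≤ (3 ^ L + 1) ^ dx := by rwa [← hR, Nat.cast_le] at hrank
  have hη' : 0 < η⁻¹ := inv_pos.2 hη
  have hL : L ≠ 0 := by
    rintro rfl
    rw [pow_zero] at hdepth
    linarith
  have hlogη : -(L : ℝ) ≤ Real.logb 3 η :=
    neg_natCast_le_logb_of_inv_le_pow (by norm_num) hη (by linarith)
  refine ⟨R, hR.symm, ?_⟩
  calc Real.log R ≤ Real.log 4 * (L * dx) := log_le_of_le_three_pow_add_one_pow hL hRle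
    _ ≤ Real.log 4 * (2 * (L + 0.5 * Real.logb 3 η) * dx) := by
      gcongr
      linarith
    _ = 2 * Real.log 4 * ((L + 0.5 * Real.logb 3 η) * dx) := by ring

theorem theorem1 :
    ∃ (C : ℝ) (κ : ℕ), 0 < C ∧
      ∀ (L H da dx V N : ℕ), H * da = dx → N < dx →
      ∀ (η : ℝ), 0 < η → η ≤ 1 →
        2 * (1 + η) * (dx : ℝ) / η < 3 ^ L →
        2 * (1 + η) * (dx : ℝ) ^ 2 < 3 ^ L →
      ∀ (θ : Params L H da dx V) (S₁ : Fin (N + 1) → Fin V) (S₂ : Fin N → Fin V)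
        (A B : Set (Fin dx → ℝ)) (p : Fin dx) (i : Fin N)
        (Λmin Λmax : ℝ), 0 < Λmin → Λmin ≤ Λmax →
        -- all parameters, and all gradients of the loss on `S₁`, are bounded
        (∀ k, Λmin ≤ |θ k| ∧ |θ k| ≤ Λmax) →
        (∀ a ∈ A, ∀ k, Λmin ≤ |partialDeriv (lossAssoc S₁ a) θ k| ∧
          |partialDeriv (lossAssoc S₁ a) θ k| ≤ Λmax) →
        -- a representation as a sum of terms whose sum of absolute values is below `M`
      ∀ (M : ℝ), 0 ≤ M →
      ∀ (n : ℕ) (term : Fin n → (Fin dx → ℝ) → (Fin dx → ℝ) → ℝ),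
        (∀ a ∈ A, ∀ b ∈ B, seqRepAssoc θ η S₁ S₂ a b i p = ∑ m, term m a b) →
        (∀ a ∈ A, ∀ b ∈ B, ∑ m, |term m a b| < M) →
      ∀ (ε : ℝ), 0 < ε →
        ∃ R : ℕ, epsSeqSep ε θ η S₁ S₂ A B p i = (R : ℕ∞) ∧
          Real.log R ≤
            C * (1 + Real.log dx + Real.log L + Real.log H) ^ κ *
              ((L + 0.5 * Real.logb 3 η) * dx) := by
  refine ⟨2 * Real.log 4, 0, by positivity, fun L H da dx V N _ _ η hη _ hdepth _ θ S₁ S₂ A B p i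
    _ _ _ _ _ _ _ _ _ _ _ _ ε hε => ?_⟩
  have hdx : (1 : ℝ) ≤ dx := Nat.one_le_cast.2 p.pos
  simpa only [pow_zero, mul_one] using theorem1_general hη
    ((one_add_inv_le_two_mul_div hη hdx).trans hdepth.le) hε.le θ S₁ S₂ A B p i
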